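/- Let $\omega=\{0,1,2,\dots\}$ and let $\mathcal{M}\subset[0,\infty)^{\omega\times\omega}$ be Vershik's space, i.e. the set of all metrics on $\omega$ with the topology of pointwise convergence, which is a Polish space. For $d\in\mathcal{M}$ let $M_d$ denote the completion of the metric space $(\omega,d)$. A metric space is called purely 1-unrectifiable if it contains no bi-Lipschitz copy of any compact subset of $\mathbb{R}$ of strictly positive Lebesgue measure. A subset of a Polish space is $\mathbf{\Pi}^1_1$ if its complement is analytic. A subset $B$ of a Polish space $Y$ is $\mathbf{\Pi}^1_1$-complete if $B$ is $\mathbf{\Pi}^1_1$ and, for every zero-dimensional Polish space $X$ and every $\mathbf{\Pi}^1_1$ set $A\subset X$, there is a continuous map $f:X\to Y$ with $A=f^{-1}(B)$. Then the sets $$\{d\in\mathcal{M} : M_d \text{ is (topologically) discrete}\}\quad\text{and}\quad\{d\in\mathcal{M} : M_d \text{ is purely 1-unrectifiable}\}$$ are both $\mathbf{\Pi}^1_1$-complete. -/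

import Mathlib

open Set TopologicalSpace MeasureTheory
open scoped NNReal

universe u v

/-- A subset of a Polish space is coanalytic (`Π¹₁`) if its complement is analytic (`Σ¹₁`). -/
def IsCoanalytic {X : Type*} [TopologicalSpace X] [PolishSpace X] (A : Set X) : Prop :=
  AnalyticSet Aᶜ

/-- `A ⊆ X` is (continuously) reducible to `B ⊆ Y` if `A = f ⁻¹ B` for some continuous
`f : X → Y`. -/
def IsReducibleTo {X Y : Type*} [TopologicalSpace X] [TopologicalSpace Y]
    (A : Set X) (B : Set Y) : Prop :=
  ∃ f : X → Y, Continuous f ∧ A = f ⁻¹' B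

/-- A topological space is zero-dimensional if it is Hausdorff and its clopen sets form a basis. -/
def IsZeroDimensional (X : Type*) [TopologicalSpace X] : Prop :=
  T2Space X ∧ IsTopologicalBasis {U : Set X | IsClopen U}

/-- `B ⊆ Y` is `Π¹₁`-complete: it is coanalytic, and every coanalytic subset of every
zero-dimensional Polish space (in an arbitrary universe `u`) is reducible to it. -/
def IsCoanalyticComplete {Y : Type v} [TopologicalSpace Y] [PolishSpace Y]
    (B : Set Y) : Prop :=
  IsCoanalytic B ∧
    ∀ (X : Type u) [TopologicalSpace X] [PolishSpace X], IsZeroDimensional X →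
      ∀ A : Set X, IsCoanalytic A → IsReducibleTo A B

/-- A metric space is purely 1-unrectifiable if it contains no Lipschitz isomorphic
(i.e. bi-Lipschitz) copy of a compact subset of `ℝ` of strictly positive Lebesgue measure. -/
def IsPurelyOneUnrectifiable (M : Type*) [MetricSpace M] : Prop :=
  ∀ K : Set ℝ, IsCompact K → 0 < volume K →
    ¬ ∃ (f : K → M) (a b : ℝ≥0), LipschitzWith a f ∧ AntilipschitzWith b f

/-- Vershik's space: the set of all metrics on `ℕ`, as a subset of `[0, ∞)^(ℕ × ℕ)`. -/
def vershikSet : Set (ℕ × ℕ → ℝ≥0) :=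
  {d | (∀ i j, d (i, j) = 0 ↔ i = j) ∧ (∀ i j, d (i, j) = d (j, i)) ∧
    ∀ i j k, d (i, k) ≤ d (i, j) + d (j, k)}

/-- Vershik's space with the topology of pointwise convergence. -/
abbrev VershikSpace : Type := vershikSet

/-- The set `ℕ`, regarded as a metric space with the metric `d`. -/
def VershikSpace.Points (_d : VershikSpace) : Type := ℕ

noncomputable instance VershikSpace.Points.instMetricSpace (d : VershikSpace) :
    MetricSpace d.Points where
  dist (i : ℕ) (j : ℕ) := (d.1 (i, j) : ℝ)
  dist_self (i : ℕ) := by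
    show (d.1 (i, i) : ℝ) = 0
    exact_mod_cast (d.2.1 i i).2 rfl
  dist_comm (i : ℕ) (j : ℕ) := by
    show (d.1 (i, j) : ℝ) = (d.1 (j, i) : ℝ)
    exact_mod_cast d.2.2.1 i j
  dist_triangle (i : ℕ) (j : ℕ) (k : ℕ) := by
    show (d.1 (i, k) : ℝ) ≤ (d.1 (i, j) : ℝ) + (d.1 (j, k) : ℝ)
    exact_mod_cast d.2.2.2 i j k
  eq_of_dist_eq_zero := by
    intro (i : ℕ) (j : ℕ) h
    have h' : (d.1 (i, j) : ℝ) = 0 := h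
    exact (d.2.1 i j).1 (by exact_mod_cast h')

/-- The completion `M_d` of the metric space `(ℕ, d)`. -/
abbrev VershikSpace.Completion (d : VershikSpace) : Type :=
  UniformSpace.Completion d.Points

/-- The set of metrics `d` on `ℕ` for which `M_d` is a discrete topological space. -/
def vershikDiscrete : Set VershikSpace :=
  {d | DiscreteTopology d.Completion}

/-- The set of metrics `d` on `ℕ` for which `M_d` is purely 1-unrectifiable. -/
def vershikP1U : Set VershikSpace :=
  {d | IsPurelyOneUnrectifiable d.Completion}

theorem VershikSpace.continuous_inv :
    Continuous (fun (d : VershikSpace) (p : ℕ × ℕ) => (d.1 p)⁻¹) := by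
  refine continuous_pi fun p => ?_
  have hp : Continuous fun d : VershikSpace => d.1 p :=
    (continuous_apply p).comp continuous_subtype_val
  by_cases h : p.1 = p.2
  · have h0 : ∀ d : VershikSpace, d.1 p = 0 := fun d => (d.2.1 p.1 p.2).2 h
    simp only [h0, inv_zero]
    exact continuous_const
  · exact hp.inv₀ fun d h0 => h ((d.2.1 p.1 p.2).1 h0)

/-- Vershik's space is Polish: `d ↦ (d, 1 / d)` embeds it as a closed subset of a Polish space. -/
instance VershikSpace.instPolishSpace : PolishSpace VershikSpace := by
  let φ : VershikSpace → (ℕ × ℕ → ℝ≥0) × (ℕ × ℕ → ℝ≥0) := fun d => (d.1, fun p => (d.1 p)⁻¹)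
  have hφ : Continuous φ := continuous_subtype_val.prodMk VershikSpace.continuous_inv
  have hrange : range φ =
      {q | (∀ i, q.1 (i, i) = 0) ∧ (∀ i, q.2 (i, i) = 0) ∧ (∀ i j, q.1 (i, j) = q.1 (j, i)) ∧
        (∀ i j k, q.1 (i, k) ≤ q.1 (i, j) + q.1 (j, k)) ∧
        ∀ i j, i ≠ j → q.1 (i, j) * q.2 (i, j) = 1} := by
    ext ⟨d, e⟩
    simp only [mem_range, mem_ofPred_eq]
    constructor
    · rintro ⟨d', h⟩
      obtain ⟨rfl, rfl⟩ := Prod.mk.inj h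
      have h0 : ∀ i, d'.1 (i, i) = 0 := fun i => (d'.2.1 i i).2 rfl
      refine ⟨h0, fun i => by simp [h0 i], d'.2.2.1, d'.2.2.2, fun i j hij => ?_⟩
      exact mul_inv_cancel₀ fun h => hij ((d'.2.1 i j).1 h)
    · rintro ⟨h1, h2, h3, h4, h5⟩
      refine ⟨⟨d, fun i j => ⟨fun h => ?_, fun h => h ▸ h1 i⟩, h3, h4⟩, Prod.ext rfl ?_⟩
      · by_contra hij
        have := h5 i j hij
        simp [h] at this
      · funext ⟨i, j⟩
        by_cases hij : i = j
        · subst hij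
          simp [φ, h1, h2]
        · exact (eq_inv_of_mul_eq_one_right (h5 i j hij)).symm
  have hclosed : IsClosed (range φ) := by
    rw [hrange]
    simp only [ofPred_and, ofPred_forall]
    have c1 : ∀ p, Continuous fun q : (ℕ × ℕ → ℝ≥0) × (ℕ × ℕ → ℝ≥0) => q.1 p :=
      fun p => (continuous_apply p).comp continuous_fst
    have c2 : ∀ p, Continuous fun q : (ℕ × ℕ → ℝ≥0) × (ℕ × ℕ → ℝ≥0) => q.2 p :=
      fun p => (continuous_apply p).comp continuous_snd
    refine (isClosed_iInter fun i => isClosed_eq (c1 _) continuous_const).inter <|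
      (isClosed_iInter fun i => isClosed_eq (c2 _) continuous_const).inter <|
      (isClosed_iInter fun i => isClosed_iInter fun j => isClosed_eq (c1 _) (c1 _)).inter <|
      (isClosed_iInter fun i => isClosed_iInter fun j => isClosed_iInter fun k =>
        isClosed_le (c1 _) ((c1 _).add (c1 _))).inter <|
      isClosed_iInter fun i => isClosed_iInter fun j => isClosed_iInter fun _ =>
        isClosed_eq ((c1 _).mul (c2 _)) continuous_const
  have hemb : Topology.IsClosedEmbedding φ :=
    ⟨.of_comp hφ continuous_fst Topology.IsEmbedding.subtypeVal, hclosed⟩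
  exact hemb.polishSpace

/-! Upper bound: failure of either property is witnessed by a point of a Polish space subject to
Borel conditions. A non-isolated point of `M_d` yields a fast Cauchy subsequence of distinct points
of `ω`. A bi-Lipschitz copy of a compact set of positive measure is coded by a sequence in `ℝ × ω`
that approximates its graph. The complements are therefore projections of Borel sets.

Hardness: a discrete space is purely 1-unrectifiable, so it suffices to find one continuous map
sending `A` to discrete completions and `Aᶜ` to completions containing a line. A clopen Souslin
scheme for `Aᶜ` attaches to each `x` a tree `T` on `ω` that has an infinite branch iff `x ∉ A`. A
node `s` of `T` is replaced by finitely many rational points on the fibre over `s` in Baire space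
times `ℝ`, the number growing with the length of `s`. Along an infinite branch these points
accumulate on a whole copy of `ℝ` (`branch_mem_closure_range_treePoint`). Without a branch they are
locally finite (`finite_setOf_treePoint_mem`), and the completion is discrete. -/

open Filter Topology

/-! ### Completions, and coanalyticity of discreteness -/

/-- The natural number `i` as a point of the metric space `(ℕ, d)`. -/
def VershikSpace.point (d : VershikSpace) (i : ℕ) : d.Points := i

/-- The canonical map from `ℕ` to the completion `M_d`. -/
noncomputable def VershikSpace.toCompletion (d : VershikSpace) (i : ℕ) : d.Completion :=
  (d.point i : d.Completion)

theorem VershikSpace.dist_toCompletion (d : VershikSpace) (i j : ℕ) :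
    dist (d.toCompletion i) (d.toCompletion j) = d.1 (i, j) :=
  UniformSpace.Completion.dist_eq _ _

theorem VershikSpace.denseRange_toCompletion (d : VershikSpace) : DenseRange d.toCompletion :=
  UniformSpace.Completion.denseRange_coe (α := d.Points)

theorem VershikSpace.toCompletion_injective (d : VershikSpace) :
    Function.Injective d.toCompletion := by
  intro i j h
  have := d.dist_toCompletion i j
  rw [h, dist_self] at this
  exact (d.2.1 i j).1 (by exact_mod_cast this.symm)

/-- In a `T₁` space, every point with a neighbourhood that meets a dense sequence in finitely many
indices is isolated. -/
theorem DenseRange.isOpen_singleton_of_finite {M ι : Type*} [TopologicalSpace M] [T1Space M]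
    {f : ι → M} (hf : DenseRange f) {y : M} {U : Set M} (hU : U ∈ 𝓝 y)
    (hfin : {i | f i ∈ U}.Finite) : IsOpen ({y} : Set M) := by
  obtain ⟨V, hVU, hV, hyV⟩ := mem_nhds_iff.1 hU
  have hfinV : (V ∩ range f).Finite := by
    refine ((hfin.subset fun i (hi : f i ∈ V) => hVU hi).image f).subset ?_
    rintro _ ⟨hi, i, rfl⟩
    exact ⟨i, hi, rfl⟩
  refine isOpen_singleton_of_finite_mem_nhds y (hV.mem_nhds hyV) (hfinV.subset ?_)
  intro z hz
  have := hV.inter_closure (t := range f) ⟨hz, hf z⟩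
  rwa [hfinV.isClosed.closure_eq] at this

theorem MeasurableSet.analyticSet_image_fst {Y Z : Type*} [TopologicalSpace Y] [PolishSpace Y]
    [MeasurableSpace Y] [BorelSpace Y] [TopologicalSpace Z] [PolishSpace Z] [MeasurableSpace Z]
    [BorelSpace Z] {B : Set (Y × Z)} (hB : MeasurableSet B) : AnalyticSet (Prod.fst '' B) :=
  hB.analyticSet.image_of_continuous continuous_fst

/-- A non-isolated point is approached by infinitely many terms of the dense sequence; conversely, a
convergent sequence of distinct points cannot have an isolated limit. The explicit rate `1 / (n +
1)` makes the condition Borel in `(d, α)`. -/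
theorem VershikSpace.not_discreteTopology_iff (d : VershikSpace) :
    ¬ DiscreteTopology d.Completion ↔
      ∃ α : ℕ → ℕ, StrictMono α ∧ ∀ n m, n ≤ m → (d.1 (α n, α m) : ℝ) ≤ 1 / (n + 1) := by
  constructor
  · intro h
    obtain ⟨y, hy⟩ : ∃ y : d.Completion, ¬ IsOpen ({y} : Set d.Completion) := by
      by_contra! hall
      exact h (discreteTopology_iff_isOpen_singleton.2 hall)
    have hfreq : ∀ n : ℕ, ∃ᶠ k in atTop, dist (d.toCompletion k) y < 1 / (2 * (n + 1)) := by
      intro n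
      rw [Nat.frequently_atTop_iff_infinite]
      intro hfin
      exact hy (d.denseRange_toCompletion.isOpen_singleton_of_finite
        (Metric.ball_mem_nhds y (by positivity)) hfin)
    obtain ⟨α, hα, hd⟩ := extraction_forall_of_frequently hfreq
    refine ⟨α, hα, fun n m hnm => ?_⟩
    rw [← d.dist_toCompletion]
    have h1 := dist_triangle_right (d.toCompletion (α n)) (d.toCompletion (α m)) y
    have h2 : (1 : ℝ) / (2 * (m + 1)) ≤ 1 / (2 * (n + 1)) := by gcongr
    have h3 : (1 : ℝ) / (2 * (n + 1)) + 1 / (2 * (n + 1)) = 1 / (n + 1) := by field_simp; norm_num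
    linarith [hd n, hd m]
  · rintro ⟨α, hα, hd⟩ hdisc
    have hc : CauchySeq fun n => d.toCompletion (α n) := by
      refine cauchySeq_of_le_tendsto_0' (fun n : ℕ => (1 : ℝ) / (n + 1)) (fun n m hnm => ?_)
        tendsto_one_div_add_atTop_nhds_zero_nat
      rw [d.dist_toCompletion]
      exact hd n m hnm
    obtain ⟨y, hy⟩ := cauchySeq_tendsto_of_complete hc
    have hev := hy (isOpen_discrete ({y} : Set d.Completion) |>.mem_nhds rfl)
    obtain ⟨n, hn⟩ := eventually_atTop.1 (mem_map.1 hev : ∀ᶠ n in atTop, d.toCompletion (α n) = y)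
    have := d.toCompletion_injective ((hn n le_rfl).trans (hn (n + 1) n.le_succ).symm)
    exact absurd this (hα n.lt_succ_self).ne

theorem VershikSpace.measurable_apply {Z : Type*} [MeasurableSpace Z] {f : Z → VershikSpace}
    {a b : Z → ℕ} (hf : Measurable f) (ha : Measurable a) (hb : Measurable b) :
    Measurable fun z => ((f z).1 (a z, b z) : ℝ) := by
  have : Measurable fun p : VershikSpace × (ℕ × ℕ) => ((p.1.1 p.2 : ℝ≥0) : ℝ) :=
    measurable_from_prod_countable_left fun q =>
      ((measurable_pi_apply q).comp measurable_subtype_coe).coe_nnreal_real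
  exact this.comp (hf.prodMk (ha.prodMk hb))

theorem isCoanalytic_vershikDiscrete : IsCoanalytic vershikDiscrete := by
  have h : vershikDiscreteᶜ = Prod.fst '' {p : VershikSpace × (ℕ → ℕ) |
      (∀ n, p.2 n < p.2 (n + 1)) ∧
        ∀ n m, n ≤ m → (p.1.1 (p.2 n, p.2 m) : ℝ) ≤ 1 / (n + 1)} := by
    ext d
    simp only [mem_compl_iff, vershikDiscrete, mem_ofPred_eq, d.not_discreteTopology_iff, mem_image,
      Prod.exists, exists_and_right, exists_eq_right]
    refine exists_congr fun α => and_congr_left fun _ => ?_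
    exact ⟨fun h n => h n.lt_succ_self, strictMono_nat_of_lt_succ⟩
  rw [IsCoanalytic, h]
  refine MeasurableSet.analyticSet_image_fst ?_
  have hα : ∀ n, Measurable fun p : VershikSpace × (ℕ → ℕ) => p.2 n :=
    fun n => (measurable_pi_apply n).comp measurable_snd
  simp only [ofPred_and, ofPred_forall]
  refine (MeasurableSet.iInter fun n => measurableSet_lt (hα _) (hα _)).inter ?_
  refine MeasurableSet.iInter fun n => MeasurableSet.iInter fun m => MeasurableSet.iInter fun _ => ?_
  exact measurableSet_le (VershikSpace.measurable_apply measurable_fst (hα _) (hα _))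
    measurable_const

/-! ### Coanalyticity of pure 1-unrectifiability -/

/-- The points that are within `1 / (m + 1)` of some term of the sequence `t` of index at least
`m`. The intersection over all `m` is the set of cluster points of `t`. -/
def tailNeighborhood (t : ℕ → ℝ) (m : ℕ) : Set ℝ :=
  {x | ∃ n, m ≤ n ∧ |x - t n| < 1 / (m + 1)}

/-- The sequence `n ↦ (t n, a n)` approximates the graph of an `L`-bi-Lipschitz map from a bounded
set of positive measure to `M_d`. -/
structure VershikSpace.IsApproxBiLipschitz (d : VershikSpace) (L : ℕ) (t : ℕ → ℝ) (a : ℕ → ℕ) :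
    Prop where
  abs_le : ∀ n, |t n| ≤ L
  le_volume : ∀ m, ENNReal.ofReal (1 / (L + 1)) ≤ volume (tailNeighborhood t m)
  dist_le : ∀ m n, m ≤ n → (d.1 (a m, a n) : ℝ) ≤ L * |t m - t n| + 1 / (m + 1)
  le_dist : ∀ m n, m ≤ n → |t m - t n| ≤ L * (d.1 (a m, a n) : ℝ) + 1 / (m + 1)

theorem tailNeighborhood_eq_biUnion (t : ℕ → ℝ) (m : ℕ) :
    tailNeighborhood t m = ⋃ n ∈ Ici m, Metric.ball (t n) (1 / (m + 1)) := by
  ext x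
  simp [tailNeighborhood, Real.dist_eq]

theorem isOpen_tailNeighborhood (t : ℕ → ℝ) (m : ℕ) : IsOpen (tailNeighborhood t m) := by
  rw [tailNeighborhood_eq_biUnion]
  exact isOpen_biUnion fun _ _ => Metric.isOpen_ball

theorem antitone_tailNeighborhood (t : ℕ → ℝ) : Antitone (tailNeighborhood t) := by
  rintro m m' hm x ⟨n, hn, hx⟩
  refine ⟨n, hm.trans hn, hx.trans_le ?_⟩
  gcongr

theorem measurable_volume_tailNeighborhood (m : ℕ) :
    Measurable fun t : ℕ → ℝ => volume (tailNeighborhood t m) := by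
  have hs : MeasurableSet {p : (ℕ → ℝ) × ℝ | ∃ n, m ≤ n ∧ |p.2 - p.1 n| < 1 / (m + 1)} := by
    simp only [ofPred_exists, ofPred_and]
    refine MeasurableSet.iUnion fun n => (MeasurableSet.const _).inter (measurableSet_lt ?_
      measurable_const)
    exact (measurable_snd.sub ((measurable_pi_apply n).comp measurable_fst)).abs
  exact measurable_measure_prodMk_left hs

namespace VershikSpace.IsApproxBiLipschitz

variable {d : VershikSpace} {L : ℕ} {t : ℕ → ℝ} {a : ℕ → ℕ}

/-- The tail neighbourhoods decrease inside a bounded set, so continuity of measure from above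
preserves the uniform lower bound. -/
theorem volume_iInter_pos (h : d.IsApproxBiLipschitz L t a) :
    0 < volume (⋂ m, tailNeighborhood t m) := by
  have hfin : volume (tailNeighborhood t 0) ≠ ⊤ := by
    refine ((Metric.isBounded_ball (x := (0 : ℝ)) (r := L + 1)).subset ?_).measure_lt_top.ne
    rintro x ⟨n, -, hx⟩
    have h1 := h.abs_le n
    have h2 := abs_sub_abs_le_abs_sub x (t n)
    rw [Metric.mem_ball, dist_zero_right, Real.norm_eq_abs]
    norm_num at hx
    linarith
  have hlim := tendsto_measure_iInter_atTop (μ := volume)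
    (fun m => (isOpen_tailNeighborhood t m).measurableSet.nullMeasurableSet)
    (antitone_tailNeighborhood t) ⟨0, hfin⟩
  refine lt_of_lt_of_le ?_ (ge_of_tendsto' hlim h.le_volume)
  rw [ENNReal.ofReal_pos]
  positivity

/-- Inner regularity gives a compact `K` of positive measure among the cluster points of `t`. When
the values of `t` along chosen indices tend to `x ∈ K`, the matching points of `M_d` are Cauchy;
their limit defines the map at `x`. The additive errors vanish in the limit, leaving the constant
`L` on both sides. -/
theorem not_isPurelyOneUnrectifiable (h : d.IsApproxBiLipschitz L t a) :
    ¬ IsPurelyOneUnrectifiable d.Completion := by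
  intro hp
  obtain ⟨K, hKsub, hK, hKpos⟩ := MeasurableSet.exists_lt_isCompact
    (MeasurableSet.iInter fun m => (isOpen_tailNeighborhood t m).measurableSet)
    h.volume_iInter_pos
  refine hp K hK hKpos ?_
  have hx : ∀ (x : K) (m : ℕ), ∃ n, m ≤ n ∧ |x.1 - t n| < 1 / (m + 1) :=
    fun x m => mem_iInter.1 (hKsub x.2) m
  choose ν hν hνt using hx
  have hzero := tendsto_one_div_add_atTop_nhds_zero_nat (𝕜 := ℝ)
  have hmono : ∀ {m n : ℕ}, m ≤ n → (1 : ℝ) / (n + 1) ≤ 1 / (m + 1) := fun hmn => by gcongr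
  have htriv : ∀ i j : ℕ, ∀ m, m ≤ i → m ≤ j →
      (d.1 (a i, a j) : ℝ) ≤ L * |t i - t j| + 1 / (m + 1) ∧
      |t i - t j| ≤ L * (d.1 (a i, a j) : ℝ) + 1 / (m + 1) := by
    intro i j m hi hj
    rcases le_total i j with hij | hij
    · exact ⟨(h.dist_le i j hij).trans (by gcongr), (h.le_dist i j hij).trans (by gcongr)⟩
    · rw [abs_sub_comm, d.2.2.1]
      exact ⟨(h.dist_le j i hij).trans (by gcongr), (h.le_dist j i hij).trans (by gcongr)⟩
  have ht : ∀ x : K, Tendsto (fun m => t (ν x m)) atTop (𝓝 x) := by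
    intro x
    rw [tendsto_iff_dist_tendsto_zero]
    refine squeeze_zero (fun _ => dist_nonneg) (fun m => ?_) hzero
    rw [dist_comm]
    exact (hνt x m).le
  have hcauchy : ∀ x : K, CauchySeq fun m => d.toCompletion (a (ν x m)) := by
    intro x
    refine cauchySeq_of_le_tendsto_0' (fun m : ℕ => (2 * L + 1) * ((1 : ℝ) / (m + 1)))
      (fun m n hmn => ?_) (by simpa using hzero.const_mul (2 * (L : ℝ) + 1))
    rw [d.dist_toCompletion]
    refine (htriv _ _ m (hν x m) (hmn.trans (hν x n))).1.trans ?_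
    have h1 : |t (ν x m) - t (ν x n)| ≤ 1 / (m + 1) + 1 / (m + 1) := by
      have h2 := abs_sub_le (t (ν x m)) x (t (ν x n))
      rw [abs_sub_comm _ x.1] at h2
      linarith [hνt x m, hνt x n, hmono hmn]
    have h3 := mul_le_mul_of_nonneg_left h1 (Nat.cast_nonneg (α := ℝ) L)
    linarith
  choose f hf using fun x => cauchySeq_tendsto_of_complete (hcauchy x)
  refine ⟨f, L, L, LipschitzWith.of_dist_le_mul fun x y => ?_,
    AntilipschitzWith.of_le_mul_dist fun x y => ?_⟩
  · have hl := ((((ht x).sub (ht y)).abs).const_mul (L : ℝ)).add hzero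
    rw [add_zero] at hl
    refine le_of_tendsto_of_tendsto' ((hf x).dist (hf y)) hl fun m => ?_
    rw [d.dist_toCompletion]
    exact (htriv _ _ m (hν x m) (hν y m)).1
  · have hl := (((hf x).dist (hf y)).const_mul (L : ℝ)).add hzero
    rw [add_zero] at hl
    refine le_of_tendsto_of_tendsto' (((ht x).sub (ht y)).abs) hl fun m => ?_
    rw [d.dist_toCompletion]
    exact (htriv _ _ m (hν x m) (hν y m)).2

end VershikSpace.IsApproxBiLipschitz

theorem VershikSpace.exists_isApproxBiLipschitz (d : VershikSpace)
    (h : ¬ IsPurelyOneUnrectifiable d.Completion) : ∃ L t a, d.IsApproxBiLipschitz L t a := by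
  unfold IsPurelyOneUnrectifiable at h
  push Not at h
  obtain ⟨K, hK, hpos, f, b₁, b₂, hf₁, hf₂⟩ := h
  have hne : K.Nonempty := nonempty_of_measure_ne_zero hpos.ne'
  have : Nonempty K := hne.to_subtype
  obtain ⟨R, hR⟩ := hK.isBounded.exists_norm_le
  obtain ⟨c, hc, hcK⟩ : ∃ c : ℝ, 0 < c ∧ ENNReal.ofReal c ≤ volume K := by
    refine ⟨(volume K).toReal, ENNReal.toReal_pos hpos.ne' hK.measure_lt_top.ne, ?_⟩
    exact ENNReal.ofReal_toReal_le
  -- One integer bounds `K`, the reciprocal of its measure and both Lipschitz constants.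
  obtain ⟨L, hL⟩ := exists_nat_ge (max (max R c⁻¹) (max b₁ b₂) : ℝ)
  simp only [max_le_iff] at hL
  obtain ⟨⟨hLR, hLc⟩, hL₁, hL₂⟩ := hL
  -- Unpairing repeats every dense point at infinitely many indices, so each tail of the sequence is
  -- still dense in `K`.
  let D : ℕ → K := fun n => denseSeq K n.unpair.1
  -- With this tolerance, moving both endpoints costs at most `1 / (m + 1)` even after
  -- multiplication by `L`; `L + 1` also covers the factor `1` and keeps the denominator nonzero.
  have hδ : ∀ n : ℕ, (0 : ℝ) < 1 / (2 * (L + 1) * (n + 1)) := fun n => by positivity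
  choose a ha using fun n : ℕ =>
    (Metric.denseRange_iff.1 d.denseRange_toCompletion) (f (D n)) _ (hδ n)
  have hδ' : ∀ m n : ℕ, m ≤ n → (L + 1 : ℝ) *
      (1 / (2 * (L + 1) * (m + 1)) + 1 / (2 * (L + 1) * (n + 1))) ≤ 1 / (m + 1) := by
    intro m n hmn
    have h1 : (1 : ℝ) / (2 * (L + 1) * (n + 1)) ≤ 1 / (2 * (L + 1) * (m + 1)) := by gcongr
    calc (L + 1 : ℝ) * (1 / (2 * (L + 1) * (m + 1)) + 1 / (2 * (L + 1) * (n + 1)))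
        ≤ (L + 1) * (1 / (2 * (L + 1) * (m + 1)) + 1 / (2 * (L + 1) * (m + 1))) := by gcongr
      _ = 1 / (m + 1) := by
        field_simp
        norm_num
  refine ⟨L, fun n => D n, a, ⟨fun n => (hR _ (D n).2).trans hLR, fun m => ?_,
    fun m n hmn => ?_, fun m n hmn => ?_⟩⟩
  · refine le_trans (ENNReal.ofReal_le_ofReal ?_) (hcK.trans (measure_mono fun x hx => ?_))
    · rw [one_div]
      exact inv_le_of_inv_le₀ hc (by linarith)
    · obtain ⟨k, hk⟩ := (Metric.denseRange_iff.1 (denseRange_denseSeq K)) ⟨x, hx⟩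
        (1 / (m + 1) : ℝ) (by positivity)
      refine ⟨Nat.pair k m, Nat.right_le_pair k m, ?_⟩
      simpa [D, Subtype.dist_eq, Real.dist_eq] using hk
  · have h1 := hf₁.dist_le_mul (D m) (D n)
    have h2 := dist_triangle4 (d.toCompletion (a m)) (f (D m)) (f (D n)) (d.toCompletion (a n))
    rw [d.dist_toCompletion, dist_comm _ (f (D m))] at h2
    have h3 : (b₁ : ℝ) * dist (D m) (D n) ≤ L * |(D m : ℝ) - D n| :=
      mul_le_mul_of_nonneg_right hL₁ dist_nonneg
    have h4 := hδ' m n hmn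
    have h5 := hδ m
    have h6 := hδ n
    have h7 : (0 : ℝ) ≤ L := Nat.cast_nonneg L
    have h8 := ha m
    have h9 := ha n
    nlinarith
  · have h1 := hf₂.le_mul_dist (D m) (D n)
    have h2 := dist_triangle4 (f (D m)) (d.toCompletion (a m)) (d.toCompletion (a n)) (f (D n))
    rw [d.dist_toCompletion, dist_comm (d.toCompletion (a n))] at h2
    have h3 : (b₂ : ℝ) * dist (f (D m)) (f (D n)) ≤ L * dist (f (D m)) (f (D n)) :=
      mul_le_mul_of_nonneg_right hL₂ dist_nonneg
    have h4 := hδ' m n hmn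
    have h5 := hδ m
    have h6 := hδ n
    have h7 : (0 : ℝ) ≤ L := Nat.cast_nonneg L
    have h8 := ha m
    have h9 := ha n
    change |(D m : ℝ) - D n| ≤ _ at h1
    have h10 : (L : ℝ) * dist (f (D m)) (f (D n)) ≤ L * ((d.1 (a m, a n) : ℝ) +
      (1 / (2 * (L + 1) * (m + 1)) + 1 / (2 * (L + 1) * (n + 1)))) := by
      gcongr
      linarith
    linarith

theorem isCoanalytic_vershikP1U : IsCoanalytic vershikP1U := by
  have h : vershikP1Uᶜ = Prod.fst '' {p : VershikSpace × (ℕ × (ℕ → ℝ) × (ℕ → ℕ)) |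
      (∀ n, |p.2.2.1 n| ≤ p.2.1) ∧
      (∀ m, ENNReal.ofReal (1 / (p.2.1 + 1)) ≤ volume (tailNeighborhood p.2.2.1 m)) ∧
      (∀ m n, m ≤ n → (p.1.1 (p.2.2.2 m, p.2.2.2 n) : ℝ) ≤
        p.2.1 * |p.2.2.1 m - p.2.2.1 n| + 1 / (m + 1)) ∧
      ∀ m n, m ≤ n → |p.2.2.1 m - p.2.2.1 n| ≤
        p.2.1 * (p.1.1 (p.2.2.2 m, p.2.2.2 n) : ℝ) + 1 / (m + 1)} := by
    ext d
    constructor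
    · intro hd
      obtain ⟨L, t, a, h⟩ := d.exists_isApproxBiLipschitz hd
      exact ⟨(d, L, t, a), ⟨h.abs_le, h.le_volume, h.dist_le, h.le_dist⟩, rfl⟩
    · rintro ⟨⟨d, L, t, a⟩, ⟨h₁, h₂, h₃, h₄⟩, rfl⟩
      exact VershikSpace.IsApproxBiLipschitz.not_isPurelyOneUnrectifiable
        (L := L) (t := t) (a := a) ⟨h₁, h₂, h₃, h₄⟩
  rw [IsCoanalytic, h]
  refine MeasurableSet.analyticSet_image_fst ?_
  have hL : Measurable fun p : VershikSpace × (ℕ × (ℕ → ℝ) × (ℕ → ℕ)) => (p.2.1 : ℝ) :=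
    measurable_from_nat.comp measurable_snd.fst
  have ht : ∀ n, Measurable fun p : VershikSpace × (ℕ × (ℕ → ℝ) × (ℕ → ℕ)) => p.2.2.1 n :=
    fun n => (measurable_pi_apply n).comp measurable_snd.snd.fst
  have hd : ∀ m n, Measurable fun p : VershikSpace × (ℕ × (ℕ → ℝ) × (ℕ → ℕ)) =>
      (p.1.1 (p.2.2.2 m, p.2.2.2 n) : ℝ) := fun m n =>
    VershikSpace.measurable_apply measurable_fst
      ((measurable_pi_apply m).comp measurable_snd.snd.snd)
      ((measurable_pi_apply n).comp measurable_snd.snd.snd)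
  simp only [ofPred_and, ofPred_forall]
  refine (MeasurableSet.iInter fun n => measurableSet_le (ht n).abs hL).inter <|
    (MeasurableSet.iInter fun m => measurableSet_le (measurable_const.div
      (hL.add_const 1)).ennreal_ofReal
      ((measurable_volume_tailNeighborhood m).comp measurable_snd.snd.fst)).inter <|
    (MeasurableSet.iInter fun m => MeasurableSet.iInter fun n => MeasurableSet.iInter fun _ =>
      measurableSet_le (hd m n)
        ((hL.mul ((ht m).sub (ht n)).abs).add_const _)).inter <|
    MeasurableSet.iInter fun m => MeasurableSet.iInter fun n => MeasurableSet.iInter fun _ =>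
      measurableSet_le ((ht m).sub (ht n)).abs ((hL.mul (hd m n)).add_const _)

/-! ### Clopen Souslin schemes in zero-dimensional spaces -/

theorem isOpen_of_forall_mem_iff {X : Type*} [TopologicalSpace X] {V : ℕ → Set X}
    (hV : ∀ i, IsClopen (V i)) {n : ℕ} {S : Set X}
    (hS : ∀ x ∈ S, ∀ y, (∀ i < n, (x ∈ V i ↔ y ∈ V i)) → y ∈ S) : IsOpen S := by
  rw [isOpen_iff_mem_nhds]
  intro x hx
  have : ∀ᶠ y in 𝓝 x, ∀ i ∈ Iio n, (x ∈ V i ↔ y ∈ V i) := by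
    rw [eventually_all_finite (finite_Iio n)]
    intro i _
    by_cases hi : x ∈ V i
    · filter_upwards [(hV i).isOpen.mem_nhds hi] with y hy using iff_of_true hi hy
    · filter_upwards [(hV i).compl.isOpen.mem_nhds hi] with y hy using iff_of_false hi hy
  filter_upwards [this] with y hy using hS x hx y hy

theorem IsZeroDimensional.exists_seq_isClopen {X : Type*} [TopologicalSpace X]
    [SecondCountableTopology X] (hX : IsZeroDimensional X) :
    ∃ V : ℕ → Set X, (∀ i, IsClopen (V i)) ∧ ∀ x y, (∀ i, x ∈ V i ↔ y ∈ V i) → x = y := by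
  obtain ⟨hT2, hB⟩ := hX
  obtain ⟨B, hBsub, hBc, hB'⟩ := hB.exists_countable
  -- Inserting `univ` makes the family nonempty, hence the range of a sequence.
  obtain ⟨V, hV⟩ := (hBc.insert univ).exists_eq_range (insert_nonempty _ _)
  refine ⟨V, fun i => ?_, fun x y h => ?_⟩
  · have : V i ∈ insert univ B := hV ▸ mem_range_self i
    rcases this with h | h
    · rw [h]
      exact isClopen_univ
    · exact hBsub h
  · by_contra hne
    obtain ⟨U, hU, hxU, hUy⟩ := hB'.exists_subset_of_mem_open (show x ∈ ({y}ᶜ : Set X) from hne)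
      isOpen_compl_singleton
    obtain ⟨i, rfl⟩ : U ∈ range V := hV ▸ mem_insert_of_mem _ hU
    exact hUy ((h i).1 hxU) rfl

/-- A Souslin scheme of clopen sets for the complement of a coanalytic set. -/
theorem exists_isClopen_scheme {X : Type*} [TopologicalSpace X] [PolishSpace X]
    (hX : IsZeroDimensional X) {A : Set X} (hA : IsCoanalytic A) :
    ∃ W : List ℕ → Set X, (∀ s, IsClopen (W s)) ∧ (∀ s t, s <+: t → W t ⊆ W s) ∧
      ∀ x, x ∉ A ↔ ∃ b : ℕ → ℕ, ∀ n, x ∈ W ((List.range n).map b) := by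
  rw [IsCoanalytic, AnalyticSet] at hA
  rcases hA with hempty | ⟨g, hg, hrange⟩
  · refine ⟨fun _ => ∅, fun _ => isClopen_empty, fun _ _ _ => le_rfl, fun x => ?_⟩
    have : x ∉ Aᶜ := hempty ▸ notMem_empty x
    simpa using this
  obtain ⟨V, hV, hsep⟩ := hX.exists_seq_isClopen
  have hrange' : ∀ x, x ∉ A ↔ ∃ b, g b = x := fun x => by
    rw [← mem_compl_iff, ← hrange, mem_range]
  -- `W s` asks that some `g β`, with `β` extending `s`, be indistinguishable from `x` by the first
  -- `s.length` sets `V i`. Only finitely many `V i` matter, so `W s` is clopen.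
  refine ⟨fun s => {x | ∃ β : ℕ → ℕ, s = (List.range s.length).map β ∧
    ∀ i < s.length, (g β ∈ V i ↔ x ∈ V i)}, fun s => ?_, fun s t hst => ?_, fun x => ?_⟩
  · constructor
    · rw [← isOpen_compl_iff]
      refine isOpen_of_forall_mem_iff hV (n := s.length) ?_
      rintro x hx y hxy ⟨β, hβ, h⟩
      exact hx ⟨β, hβ, fun i hi => (h i hi).trans (hxy i hi).symm⟩
    · refine isOpen_of_forall_mem_iff hV (n := s.length) ?_
      rintro x ⟨β, hβ, h⟩ y hxy
      exact ⟨β, hβ, fun i hi => (h i hi).trans (hxy i hi)⟩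
  · rintro x ⟨β, hβ, h⟩
    refine ⟨β, ?_, fun i hi => h i (hi.trans_le hst.length_le)⟩
    have h1 := List.prefix_iff_eq_take.1 hst
    rw [hβ, ← List.map_take, List.take_range, min_eq_left hst.length_le] at h1
    exact h1
  · rw [hrange']
    constructor
    · rintro ⟨b, rfl⟩
      exact ⟨b, fun n => ⟨b, by simp, fun _ _ => Iff.rfl⟩⟩
    · rintro ⟨b, hb⟩
      refine ⟨b, hsep _ _ fun i => ?_⟩
      -- The witnesses vary with `n` but agree with `b` on longer and longer segments, so they tend
      -- to `b`; continuity of `g` and clopenness of `V i` transfer the agreement to `g b`.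
      choose β hβ h using hb
      have hlim : Tendsto β atTop (𝓝 b) := by
        rw [tendsto_pi_nhds]
        intro k
        refine tendsto_const_nhds.congr' ?_
        filter_upwards [eventually_gt_atTop k] with n hn
        have := congrArg (fun l => l[k]?) (hβ n)
        simpa [hn] using this
      have hlim' := (hg.tendsto b).comp hlim
      have hev : ∀ᶠ n in atTop, (g (β n) ∈ V i ↔ x ∈ V i) := by
        filter_upwards [eventually_gt_atTop i] with n hn
        exact h n i (by simpa using hn)
      by_cases hi : g b ∈ V i
      · obtain ⟨n, h1, h2⟩ := (hev.and (hlim' ((hV i).isOpen.mem_nhds hi))).exists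
        exact iff_of_true hi (h1.1 h2)
      · obtain ⟨n, h1, h2⟩ := (hev.and (hlim' ((hV i).compl.isOpen.mem_nhds hi))).exists
        exact iff_of_false hi fun hx => h2 (h1.2 hx)

/-! ### Metrics induced by sequences in a complete space -/

namespace VershikSpace

variable {E : Type*} [MetricSpace E]

/-- The metric on `ℕ` induced by an injective sequence in a metric space. -/
def ofInjective (P : ℕ → E) (hP : Function.Injective P) : VershikSpace :=
  ⟨fun p => nndist (P p.1) (P p.2), fun _ _ => nndist_eq_zero.trans hP.eq_iff,
    fun _ _ => nndist_comm _ _, fun _ _ _ => nndist_triangle _ _ _⟩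

variable [CompleteSpace E] {P : ℕ → E} (hP : Function.Injective P)

theorem exists_isometry_ofInjective :
    ∃ Φ : (ofInjective P hP).Completion → E, Isometry Φ ∧
      ∀ i, Φ ((ofInjective P hP).toCompletion i) = P i := by
  have hiso : Isometry (fun i : (ofInjective P hP).Points => P i) :=
    Isometry.of_dist_eq fun _ _ => rfl
  exact ⟨_, hiso.completion_extension, fun i =>
    UniformSpace.Completion.extension_coe hiso.uniformContinuous _⟩

theorem discreteTopology_ofInjective (h : ∀ e : E, ∃ U ∈ 𝓝 e, {i | P i ∈ U}.Finite) :
    DiscreteTopology (ofInjective P hP).Completion := by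
  obtain ⟨Φ, hΦ, hΦP⟩ := exists_isometry_ofInjective hP
  rw [discreteTopology_iff_isOpen_singleton]
  intro y
  obtain ⟨U, hU, hfin⟩ := h (Φ y)
  refine (denseRange_toCompletion _).isOpen_singleton_of_finite
    (hΦ.continuous.continuousAt.preimage_mem_nhds hU) ?_
  simpa only [mem_preimage, hΦP] using hfin

theorem exists_isometry_of_mem_closure {Z : Type*} [MetricSpace Z] {g : Z → E} (hg : Isometry g)
    (hgP : ∀ z, g z ∈ closure (range P)) :
    ∃ f : Z → (ofInjective P hP).Completion, Isometry f := by
  obtain ⟨Φ, hΦ, hΦP⟩ := exists_isometry_ofInjective hP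
  have hsub : closure (range P) ⊆ range Φ :=
    hΦ.isClosedEmbedding.isClosed_range.closure_subset_iff.2 <| by
      rintro _ ⟨i, rfl⟩
      exact ⟨_, hΦP i⟩
  choose f hf using fun z => hsub (hgP z)
  exact ⟨f, Isometry.of_dist_eq fun x y => by rw [← hΦ.dist_eq, hf, hf, hg.dist_eq]⟩

end VershikSpace

/-- A compact set embedding in a discrete space is finite, hence null. -/
theorem IsPurelyOneUnrectifiable.of_discreteTopology (M : Type*) [MetricSpace M]
    [DiscreteTopology M] : IsPurelyOneUnrectifiable M := by
  rintro K hK hpos ⟨f, a, b, ha, hb⟩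
  have : DiscreteTopology K := DiscreteTopology.of_continuous_injective ha.continuous hb.injective
  have : CompactSpace K := isCompact_iff_compactSpace.1 hK
  have : Finite K := finite_of_compact_of_discrete
  exact hpos.ne' (K.toFinite.measure_zero _)

theorem not_isPurelyOneUnrectifiable_of_isometry {M : Type*} [MetricSpace M] {f : ℝ → M}
    (hf : Isometry f) : ¬ IsPurelyOneUnrectifiable M := fun h =>
  h (Icc 0 1) isCompact_Icc (by simp) ⟨fun x => f x, 1, 1,
    (hf.comp isometry_subtype_coe).lipschitz, (hf.comp isometry_subtype_coe).antilipschitz⟩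

/-! ### Trees as point sets in Baire space times the line -/

/-- A finite sequence of natural numbers as a point of the Baire space: its terms are shifted by
one, preceded and followed by zeros. -/
def nodePoint (s : List ℕ) : ℕ → ℕ
  | 0 => 0
  | n + 1 => (s[n]?).elim 0 Nat.succ

theorem nodePoint_succ_eq_zero {s : List ℕ} {n : ℕ} : nodePoint s (n + 1) = 0 ↔ s.length ≤ n := by
  by_cases h : n < s.length
  · simp [nodePoint, h]
  · simp [nodePoint, not_lt.1 h]

theorem getElem?_of_nodePoint {s : List ℕ} {n k : ℕ} (h : nodePoint s (n + 1) = k + 1) :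
    s[n]? = some k := by
  rcases hs : s[n]? with _ | a
  · simp [nodePoint, hs] at h
  · simpa [nodePoint, hs] using h

theorem nodePoint_injective : Function.Injective nodePoint := by
  intro s t h
  refine List.ext_getElem? fun n => ?_
  have := congrFun h (n + 1)
  rcases ht : t[n]? with _ | b
  · have h0 : nodePoint t (n + 1) = 0 := by simp [nodePoint, ht]
    rw [h0, nodePoint_succ_eq_zero] at this
    exact List.getElem?_eq_none this
  · exact getElem?_of_nodePoint (this.trans (by simp [nodePoint, ht]))

theorem eq_map_range_of_nodePoint {s : List ℕ} {β : ℕ → ℕ} {n : ℕ}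
    (h : ∀ j < n, nodePoint s (j + 1) = β j + 1) : (List.range n).map β <+: s := by
  rw [List.prefix_iff_getElem?]
  intro i hi
  have hi' : i < n := by simpa using hi
  simp [getElem?_of_nodePoint (h i hi')]

theorem tendsto_nodePoint_map_range (b : ℕ → ℕ) :
    Tendsto (fun n => nodePoint ((List.range n).map b)) atTop
      (𝓝 fun j => Nat.casesOn j 0 fun i => b i + 1) := by
  rw [tendsto_pi_nhds]
  intro j
  refine tendsto_const_nhds.congr' ?_
  filter_upwards [eventually_ge_atTop j] with n hn
  cases j with
  | zero => rfl
  | succ i => simp [nodePoint, Nat.lt_of_succ_le hn]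

/-- A fixed enumeration of `List ℕ × ℚ`. -/
def nodeEnum : ℕ ≃ List ℕ × ℚ := (Denumerable.eqv _).symm

open Classical in
/-- The `i`-th point attached to a family of nodes `T`: if the `i`-th pair `(s, r)` has `s ∈ T` and
`r` is among the first `s.length + 1` rationals, it is placed at `(s, r)`; otherwise it is put out
of the way. -/
noncomputable def treePoint (T : Set (List ℕ)) (i : ℕ) : (ℕ → ℕ) × ℝ :=
  if (nodeEnum i).1 ∈ T ∧ Encodable.encode (nodeEnum i).2 ≤ (nodeEnum i).1.length then
    (nodePoint (nodeEnum i).1, (nodeEnum i).2) else (fun _ => i + 1, 0)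

theorem treePoint_zero_eq_zero {T : Set (List ℕ)} {i : ℕ} (h : (treePoint T i).1 0 = 0) :
    ((nodeEnum i).1 ∈ T ∧ Encodable.encode (nodeEnum i).2 ≤ (nodeEnum i).1.length) ∧
      treePoint T i = (nodePoint (nodeEnum i).1, ((nodeEnum i).2 : ℝ)) := by
  unfold treePoint at h ⊢
  split_ifs at h ⊢ with hT
  exact ⟨hT, rfl⟩

theorem treePoint_zero_eq_succ {T : Set (List ℕ)} {i k : ℕ} (h : (treePoint T i).1 0 = k + 1) :
    i = k := by
  unfold treePoint at h
  split_ifs at h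
  · simp [nodePoint] at h
  · simpa using h

theorem treePoint_injective (T : Set (List ℕ)) : Function.Injective (treePoint T) := by
  intro i j hij
  rcases h : (treePoint T i).1 0 with _ | k
  · have hi := (treePoint_zero_eq_zero h).2
    have hj := (treePoint_zero_eq_zero (hij ▸ h)).2
    rw [hi, hj, Prod.mk.injEq] at hij
    exact nodeEnum.injective (Prod.ext (nodePoint_injective hij.1) (by exact_mod_cast hij.2))
  · exact (treePoint_zero_eq_succ h).trans (treePoint_zero_eq_succ (hij ▸ h)).symm

/-- A nonzero first coordinate of `e` identifies a single discarded index. If a later coordinate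
vanishes, a cylinder bounds the node length, leaving finitely many nodes with finitely many
rationals each. Otherwise `e` lies over an infinite sequence, which leaves `T` at some finite stage.
-/
theorem finite_setOf_treePoint_mem {T : Set (List ℕ)} (hT : ∀ s t, s <+: t → t ∈ T → s ∈ T)
    (hwf : ∀ b : ℕ → ℕ, ∃ n, (List.range n).map b ∉ T) (e : (ℕ → ℕ) × ℝ) :
    ∃ U ∈ 𝓝 e, {i | treePoint T i ∈ U}.Finite := by
  obtain ⟨β, r⟩ := e
  have hU : ∀ n, Prod.fst ⁻¹' PiNat.cylinder β n ∈ 𝓝 (β, r) := fun n =>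
    continuous_fst.continuousAt.preimage_mem_nhds
      ((PiNat.isOpen_cylinder _ β n).mem_nhds (PiNat.self_mem_cylinder β n))
  rcases h0 : β 0 with _ | k
  · by_cases hz : ∃ n, β (n + 1) = 0
    · obtain ⟨n, hn⟩ := hz
      refine ⟨_, hU (n + 2), ?_⟩
      let S : Set (List ℕ × ℚ) :=
        ((fun l => (List.range l).map fun j => β (j + 1) - 1) '' Iic n) ×ˢ
          {q | Encodable.encode q ≤ n}
      have hS : S.Finite := ((finite_Iic n).image _).prod
        ((finite_Iic n).preimage Encodable.encode_injective.injOn)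
      refine (hS.preimage nodeEnum.injective.injOn).subset fun i hi => ?_
      have hi : ∀ j < n + 2, (treePoint T i).1 j = β j := PiNat.mem_cylinder_iff.1 hi
      obtain ⟨⟨-, hle⟩, heq⟩ := treePoint_zero_eq_zero ((hi 0 (by lia)).trans h0)
      rw [heq] at hi
      have hlen : (nodeEnum i).1.length ≤ n :=
        nodePoint_succ_eq_zero.1 ((hi (n + 1) (by lia)).trans hn)
      refine ⟨⟨_, hlen, ?_⟩, hle.trans hlen⟩
      refine (eq_map_range_of_nodePoint fun j hj => ?_).eq_of_length (by simp)
      have h1 := hi (j + 1) (by lia)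
      have h2 : nodePoint (nodeEnum i).1 (j + 1) ≠ 0 := fun h => by
        rw [nodePoint_succ_eq_zero] at h
        lia
      simp only at h1
      lia
    · push Not at hz
      -- Any node point in this cylinder would extend the length-`n` segment, which is not in `T`,
      -- against closure of `T` under prefixes.
      obtain ⟨n, hn⟩ := hwf fun j => β (j + 1) - 1
      refine ⟨_, hU (n + 1), finite_empty.subset fun i hi => hn ?_⟩
      have hi : ∀ j < n + 1, (treePoint T i).1 j = β j := PiNat.mem_cylinder_iff.1 hi
      obtain ⟨⟨hmem, -⟩, heq⟩ := treePoint_zero_eq_zero ((hi 0 (by lia)).trans h0)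
      rw [heq] at hi
      refine hT _ _ (eq_map_range_of_nodePoint fun j hj => ?_) hmem
      have h1 := hi (j + 1) (by lia)
      have h2 := hz j
      simp only at h1
      lia
  · refine ⟨_, hU 1, (finite_singleton k).subset fun i hi => ?_⟩
    exact treePoint_zero_eq_succ ((PiNat.mem_cylinder_iff.1 hi 0 one_pos).trans h0)

/-- Each rational `q` is admitted at all sufficiently long nodes of the branch, so its copies
converge to the limit fibre; density of the rationals fills the fibre. -/
theorem branch_mem_closure_range_treePoint {T : Set (List ℕ)} {b : ℕ → ℕ}
    (hb : ∀ n, (List.range n).map b ∈ T) (r : ℝ) :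
    ((fun j => Nat.casesOn j 0 fun i => b i + 1 : ℕ → ℕ), r) ∈ closure (range (treePoint T)) := by
  refine Rat.denseRange_cast.induction_on (p := fun r : ℝ =>
    ((fun j => Nat.casesOn j 0 fun i => b i + 1 : ℕ → ℕ), r) ∈ closure (range (treePoint T))) r
    (isClosed_closure.preimage (by fun_prop)) fun q => ?_
  refine mem_closure_of_tendsto
    ((tendsto_nodePoint_map_range b).prodMk_nhds (tendsto_const_nhds (x := (q : ℝ)))) ?_
  filter_upwards [eventually_ge_atTop (Encodable.encode q)] with n hn
  refine ⟨nodeEnum.symm ((List.range n).map b, q), ?_⟩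
  have : Encodable.encode q ≤ ((List.range n).map b).length := by simpa using hn
  rw [treePoint, Equiv.apply_symm_apply, if_pos ⟨hb n, this⟩]

/-- For fixed `i` the point takes two values, switched by membership of `x` in a clopen set. -/
theorem continuous_treePoint {X : Type*} [TopologicalSpace X] {W : List ℕ → Set X}
    (hW : ∀ s, IsClopen (W s)) (i : ℕ) : Continuous fun x => treePoint {s | x ∈ W s} i := by
  classical
  unfold treePoint
  refine Continuous.if (fun x hx => ?_) continuous_const continuous_const
  have hclopen : IsClopen {x | (nodeEnum i).1 ∈ {s | x ∈ W s} ∧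
      Encodable.encode (nodeEnum i).2 ≤ (nodeEnum i).1.length} := by
    by_cases h : Encodable.encode (nodeEnum i).2 ≤ (nodeEnum i).1.length
    · simpa [h] using hW _
    · simpa [h] using isClopen_empty
  rw [hclopen.frontier_eq] at hx
  exact hx.elim

/-- Continuous reduction of an arbitrary coanalytic set to the discrete and to the purely
1-unrectifiable metric spaces simultaneously. -/
theorem exists_continuous_reduction {X : Type*} [TopologicalSpace X] [PolishSpace X]
    (hX : IsZeroDimensional X) {A : Set X} (hA : IsCoanalytic A) :
    ∃ f : X → VershikSpace, Continuous f ∧ (∀ x ∈ A, DiscreteTopology (f x).Completion) ∧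
      ∀ x ∉ A, ¬ IsPurelyOneUnrectifiable (f x).Completion := by
  obtain ⟨W, hW, hanti, hWA⟩ := exists_isClopen_scheme hX hA
  -- Any compatible complete metric on Baire space serves; the maximum metric on the product makes
  -- each fibre isometric to `ℝ`.
  let _ := upgradeIsCompletelyMetrizable (ℕ → ℕ)
  refine ⟨fun x => VershikSpace.ofInjective _ (treePoint_injective {s | x ∈ W s}), ?_,
    fun x hx => ?_, fun x hx => ?_⟩
  · refine Continuous.subtype_mk (continuous_pi fun p => ?_) _
    exact (continuous_treePoint hW p.1).nndist (continuous_treePoint hW p.2)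
  · refine VershikSpace.discreteTopology_ofInjective _
      (finite_setOf_treePoint_mem (fun s t hst ht => hanti s t hst ht) fun b => ?_)
    by_contra! h
    exact (hWA x).2 ⟨b, h⟩ hx
  · obtain ⟨b, hb⟩ := (hWA x).1 hx
    obtain ⟨f, hf⟩ := VershikSpace.exists_isometry_of_mem_closure
      (treePoint_injective {s | x ∈ W s})
      (g := fun r : ℝ => ((fun j => Nat.casesOn j 0 fun i => b i + 1 : ℕ → ℕ), r))
      (Isometry.of_dist_eq fun r r' => by simp [Prod.dist_eq])
      (branch_mem_closure_range_treePoint hb)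
    exact not_isPurelyOneUnrectifiable_of_isometry hf

theorem mainTheorem3 :
    IsCoanalyticComplete.{u, 0} vershikDiscrete ∧ IsCoanalyticComplete.{u, 0} vershikP1U := by
  refine ⟨⟨isCoanalytic_vershikDiscrete, fun X _ _ hX A hA => ?_⟩,
    ⟨isCoanalytic_vershikP1U, fun X _ _ hX A hA => ?_⟩⟩ <;>
  obtain ⟨f, hf, hfA, hfA'⟩ := exists_continuous_reduction hX hA <;>
  refine ⟨f, hf, Subset.antisymm (fun x hx => ?_) fun x hx => by_contra fun hxA => hfA' x hxA ?_⟩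
  · exact hfA x hx
  · have : DiscreteTopology (f x).Completion := hx
    exact .of_discreteTopology _
  · have := hfA x hx
    exact IsPurelyOneUnrectifiable.of_discreteTopology _
  · exact hx
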